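/- Let $\bar\gamma>0$, $\kappa\ge 0$, $\mu>0$, $m>0$ be real numbers. The $\kappa$-$\mu$ shadowed distribution $\mathcal S_{\kappa\mu}(\bar\gamma;\kappa,\mu,m)$ is the law on $(0,\infty)$ with density $x\mapsto\int_0^\infty f(x\mid\xi)\,f_\xi(\xi)\,d\xi$, where $f_\xi(\xi)=\frac{2m^m}{\Gamma(m)}\xi^{2m-1}e^{-m\xi^2}$ is the Nakagami-$m$ density normalized by $\mathbb E[\xi^2]=1$ and $$f(x\mid\xi)=\frac{\mu(1+\kappa)^{\frac{\mu+1}{2}}}{\bar\gamma\,\kappa^{\frac{\mu-1}{2}}e^{\xi^2\mu\kappa}}\left(\frac{x}{\xi^2\bar\gamma}\right)^{\frac{\mu-1}{2}}e^{-\frac{\mu(1+\kappa)x}{\bar\gamma}}\,I_{\mu-1}\!\left(2\mu\xi\sqrt{\frac{\kappa(1+\kappa)x}{\bar\gamma}}\right)$$ is the conditional $\kappa$-$\mu$ density ($I_\nu$ is the modified Bessel function of the first kind); for $\kappa=0$, $f(x\mid\xi)$ is understood as its limit as $\kappa\to0^+$, the Gamma density with shape $\mu$ and mean $\bar\gamma$.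 Let $$\Phi_2(b,b';c;x,y)=\sum_{j,k\ge 0}\frac{(b)_j(b')_k}{(c)_{j+k}\,j!\,k!}x^jy^k$$ be the bivariate confluent hypergeometric function. Let $M\ge1$ and let $\gamma_1,\dots,\gamma_M$ be mutually independent random variables, each with law $\mathcal S_{\kappa\mu}(\bar\gamma;\kappa,\mu,m)$. Then the sum $\gamma=\sum_{k=1}^M\gamma_k$ is absolutely continuous; its PDF vanishes on $(-\infty,0]$ and, for $x>0$, is $$f_\gamma(x)=\frac{1}{\Gamma(M\mu)}\frac{\mu^{\mu M}m^{mM}(1+\kappa)^{\mu M}}{(\mu\kappa+m)^{mM}}\left(\frac1{\bar\gamma}\right)^{\mu M}x^{M\mu-1}\,\Phi_2\!\left(\mu M-mM,\,mM;\,\mu M;\,-\frac{\mu(1+\kappa)x}{\bar\gamma},\,-\frac{\mu(1+\kappa)}{\bar\gamma}\frac{mx}{\mu\kappa+m}\right),$$ and its CDF vanishes on $(-\infty,0)$ and, for $x\ge0$, is $$F_\gamma(x)=\frac{1}{\Gamma(1+M\mu)}\frac{\mu^{\mu M}m^{mM}(1+\kappa)^{\mu M}}{(\mu\kappa+m)^{mM}}\left(\frac1{\bar\gamma}\right)^{\mu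 M}x^{M\mu}\,\Phi_2\!\left(\mu M-mM,\,mM;\,1+\mu M;\,-\frac{\mu(1+\kappa)x}{\bar\gamma},\,-\frac{\mu(1+\kappa)}{\bar\gamma}\frac{mx}{\mu\kappa+m}\right).$$ -/

import Mathlib

open MeasureTheory ProbabilityTheory
open scoped ENNReal Nat

noncomputable section

/-- The confluent hypergeometric function of two variables (Humbert's function)
`Φ₂(b, b'; c; x, y) = ∑_{j,k ≥ 0} (b)_j (b')_k / ((c)_{j+k} j! k!) x^j y^k`, with `(a)_n` the
rising factorial. For `c > 0` the double series converges absolutely for all real `x`, `y`. -/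
def humbertPhi2 (b b' c x y : ℝ) : ℝ :=
  ∑' p : ℕ × ℕ,
    ((ascPochhammer ℝ p.1).eval b * (ascPochhammer ℝ p.2).eval b') /
      ((ascPochhammer ℝ (p.1 + p.2)).eval c * ((p.1)! : ℝ) * ((p.2)! : ℝ)) *
      x ^ p.1 * y ^ p.2

/-- The modified Bessel function of the first kind `I_ν(z)`, for real `z > 0` and `ν > -1`. -/
def besselI (ν z : ℝ) : ℝ :=
  ∑' k : ℕ, (z / 2) ^ (2 * (k : ℝ) + ν) / ((k ! : ℝ) * Real.Gamma ((k : ℝ) + ν + 1))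

/-- The density of a Nakagami-`m` random variable `ξ` normalized so that `E[ξ ^ 2] = 1`. -/
def nakagamiPDFReal (m ξ : ℝ) : ℝ :=
  if 0 < ξ then
    2 * m ^ m / Real.Gamma m * ξ ^ (2 * m - 1) * Real.exp (-(m * ξ ^ 2))
  else 0

/-- The conditional density at `x` of the instantaneous signal-to-noise ratio, given the shadowing
amplitude `ξ > 0`: a `κ`-`μ` density whose dominant components are scaled by `ξ`. The Bessel formula
is of the form `0 / 0` at `κ = 0`; there the value is its limit as `κ → 0⁺`, the Gamma
density with shape `μ` and mean `γbar`. -/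
def kappaMuCondPDFReal (γbar κ μ ξ x : ℝ) : ℝ :=
  if 0 < x then
    if κ = 0 then gammaPDFReal μ (μ / γbar) x
    else
      μ * (1 + κ) ^ ((μ + 1) / 2) /
          (γbar * κ ^ ((μ - 1) / 2) * Real.exp (ξ ^ 2 * μ * κ)) *
        (x / (ξ ^ 2 * γbar)) ^ ((μ - 1) / 2) *
        Real.exp (-(μ * (1 + κ) * x / γbar)) *
        besselI (μ - 1) (2 * μ * ξ * Real.sqrt (κ * (1 + κ) * x / γbar))
  else 0

/-- The `κ`-`μ` shadowed distribution `S_{κμ}(γbar; κ, μ, m)`: the mixture of the conditional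
`κ`-`μ` laws given `ξ`, over a normalized Nakagami-`m` amplitude `ξ`. -/
def kappaMuShadowedMeasure (γbar κ μ m : ℝ) : Measure ℝ :=
  volume.withDensity fun x =>
    ∫⁻ ξ in Set.Ioi (0 : ℝ),
      ENNReal.ofReal (kappaMuCondPDFReal γbar κ μ ξ x) * ENNReal.ofReal (nakagamiPDFReal m ξ)

/-- The closed-form density on `x > 0` for the sum of `M` independent variables with law
`S_{κμ}(γbar; κ, μ, m)`. -/
def kappaMuShadowedSumPDFReal (M : ℕ) (γbar κ μ m x : ℝ) : ℝ :=
  1 / Real.Gamma (M * μ) *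
    (μ ^ (μ * M) * m ^ (m * M) * (1 + κ) ^ (μ * M) / (μ * κ + m) ^ (m * M)) *
    (1 / γbar) ^ (μ * M) * x ^ (M * μ - 1) *
    humbertPhi2 (μ * M - m * M) (m * M) (μ * M)
      (-(μ * (1 + κ) * x) / γbar)
      (-(μ * (1 + κ)) / γbar * (m * x / (μ * κ + m)))

/-- The closed-form cumulative distribution function on `x ≥ 0` for the sum of `M` independent
variables with law `S_{κμ}(γbar; κ, μ, m)`. -/
def kappaMuShadowedSumCDFReal (M : ℕ) (γbar κ μ m x : ℝ) : ℝ :=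
  1 / Real.Gamma (1 + M * μ) *
    (μ ^ (μ * M) * m ^ (m * M) * (1 + κ) ^ (μ * M) / (μ * κ + m) ^ (m * M)) *
    (1 / γbar) ^ (μ * M) * x ^ (M * μ) *
    humbertPhi2 (μ * M - m * M) (m * M) (1 + μ * M)
      (-(μ * (1 + κ) * x) / γbar)
      (-(μ * (1 + κ)) / γbar * (m * x / (μ * κ + m)))

end

/-! Everything reduces to negative binomial mixtures of Gamma laws. Put `r = μ(1+κ)/γbar` and `p =
m/(μκ+m)`. Given `ξ`, expanding the Bessel function shows the conditional law to be a Poisson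
mixture, of mean `ξ²μκ`, of the Gamma laws with shape `μ+k` and rate `r`
(`kappaMuCondPDFReal_eq_tsum`). Since `ξ²` is Gamma distributed, averaging over `ξ` turns the
Poisson weights into negative binomial ones with shape `m` and success probability `p`, so each
summand has law `gammaMixture μ m p r`.

By the binomial series the characteristic function of `gammaMixture a b p r` is `w^a
(p/(1-(1-p)w))^b` with `w = r/(r-it)`. Its `M`-th power has the same form with parameters `Ma`,
`Mb`, which identifies the law of the sum (`map_sum_eq_gammaMixture`).

The density of a mixture is a Gamma density times `p^b ₁F₁(b; a; (1-p)rx)`. The identity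
`humbertPhi2_sub_eq` absorbs `e^{-rx}` and produces `Φ₂`; termwise integration
(`integral_rpow_mul_humbertPhi2`) then gives the distribution function. -/

section Pochhammer

/-! ### Rising factorials: bounds and the Chu-Vandermonde identity -/

theorem ascPochhammer_eval_nonneg {a : ℝ} (ha : 0 ≤ a) (n : ℕ) :
    0 ≤ (ascPochhammer ℝ n).eval a := by
  induction n with
  | zero => simp
  | succ n ih => rw [ascPochhammer_succ_eval]; positivity

theorem abs_ascPochhammer_eval_le (b : ℝ) (n : ℕ) :
    |(ascPochhammer ℝ n).eval b| ≤ (ascPochhammer ℝ n).eval |b| := by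
  induction n with
  | zero => simp
  | succ n ih =>
    rw [ascPochhammer_succ_eval, ascPochhammer_succ_eval, abs_mul]
    refine mul_le_mul ih ((abs_add_le _ _).trans (by simp)) (abs_nonneg _) ?_
    exact ascPochhammer_eval_nonneg (abs_nonneg b) n

/-- Ratios of rising factorials grow at most geometrically. -/
theorem ascPochhammer_eval_div_le_pow {a d : ℝ} (ha : 0 < a) (hd : 0 ≤ d) (n : ℕ) :
    (ascPochhammer ℝ n).eval d / (ascPochhammer ℝ n).eval a ≤ (max 1 (d / a)) ^ n := by
  induction n with
  | zero => simp
  | succ n ih =>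
    rw [ascPochhammer_succ_eval, ascPochhammer_succ_eval, mul_div_mul_comm, pow_succ]
    refine mul_le_mul ih ?_ (by positivity) (by positivity)
    rw [div_le_iff₀ (by positivity)]
    have h1 : d ≤ max 1 (d / a) * a := by
      rw [← div_le_iff₀ ha]; exact le_max_right _ _
    have h2 : (n : ℝ) ≤ max 1 (d / a) * n :=
      le_mul_of_one_le_left (Nat.cast_nonneg n) (le_max_left _ _)
    linarith

/-- Each factor `a + i` of the second product is at most the factor `a + j + i` on the right. This
decouples the two indices in the denominator of `Φ₂`. -/
theorem ascPochhammer_eval_mul_le {a : ℝ} (ha : 0 < a) (j k : ℕ) :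
    (ascPochhammer ℝ j).eval a * (ascPochhammer ℝ k).eval a ≤
      (ascPochhammer ℝ (j + k)).eval a := by
  induction k with
  | zero => simp
  | succ k ih =>
    rw [← add_assoc, ascPochhammer_succ_eval, ascPochhammer_succ_eval, ← mul_assoc]
    refine mul_le_mul ih ?_ (by positivity) (ascPochhammer_eval_nonneg ha.le _)
    push_cast
    linarith [(Nat.cast_nonneg j : (0 : ℝ) ≤ j)]

theorem Real.Gamma_add_natCast {a : ℝ} (ha : 0 < a) (n : ℕ) :
    Real.Gamma (a + n) = Real.Gamma a * (ascPochhammer ℝ n).eval a := by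
  induction n with
  | zero => simp
  | succ n ih =>
    rw [ascPochhammer_succ_eval, ← mul_assoc, ← ih, Nat.cast_succ, ← add_assoc,
      Real.Gamma_add_one (by positivity)]
    ring

/-- Both sides are `a(a+1)⋯(a+n)`. Integration uses it to raise the parameter `c` of `Φ₂` to `c +
1`. -/
theorem ascPochhammer_eval_mul_add {a : ℝ} (n : ℕ) :
    (ascPochhammer ℝ n).eval a * (a + n) = a * (ascPochhammer ℝ n).eval (a + 1) := by
  induction n with
  | zero => simp
  | succ n ih =>
    rw [ascPochhammer_succ_eval, ascPochhammer_succ_eval, ih]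
    push_cast
    ring

/-- A form of the Chu-Vandermonde identity: the `n`-th alternating difference of the ratio of
rising factorials `(b)_k / (a)_k`. -/
theorem sum_choose_neg_one_pow_mul_ascPochhammer_div {a b : ℝ} (ha : 0 < a) (n k : ℕ) :
    ∑ l ∈ Finset.range (n + 1), (n.choose l : ℝ) * ((-1) ^ l *
      ((ascPochhammer ℝ (k + l)).eval b / (ascPochhammer ℝ (k + l)).eval a)) =
    (ascPochhammer ℝ n).eval (a - b) * (ascPochhammer ℝ k).eval b /
      (ascPochhammer ℝ (n + k)).eval a := by
  induction n generalizing k with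
  | zero => simp
  | succ n ih =>
    -- Pascal's rule; the shifted sum is the induction hypothesis at `k + 1`, with opposite sign.
    have key : ∀ f : ℕ → ℝ, ∑ l ∈ Finset.range (n + 1 + 1), ((n + 1).choose l : ℝ) * f l =
        ∑ l ∈ Finset.range (n + 1), (n.choose l : ℝ) * f l +
          ∑ l ∈ Finset.range (n + 1), (n.choose l : ℝ) * f (l + 1) := by
      intro f
      rw [Finset.sum_range_succ']
      simp only [Nat.choose_succ_succ, Nat.cast_add, add_mul, Finset.sum_add_distrib]
      rw [add_comm (∑ l ∈ Finset.range (n + 1), (n.choose l : ℝ) * f (l + 1)), add_right_comm]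
      congr 1
      rw [Finset.sum_range_succ, Finset.sum_range_succ' _ n]
      simp
    rw [key, ih k]
    have h2 : ∑ l ∈ Finset.range (n + 1), (n.choose l : ℝ) * ((-1) ^ (l + 1) *
        ((ascPochhammer ℝ (k + (l + 1))).eval b / (ascPochhammer ℝ (k + (l + 1))).eval a)) =
        - ((ascPochhammer ℝ n).eval (a - b) * (ascPochhammer ℝ (k + 1)).eval b /
      (ascPochhammer ℝ (n + (k + 1))).eval a) := by
      rw [← ih (k + 1), ← Finset.sum_neg_distrib]
      refine Finset.sum_congr rfl fun l _ => ?_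
      rw [show k + (l + 1) = k + 1 + l by ring]
      ring
    rw [h2, show n + (k + 1) = n + k + 1 by ring, show n + 1 + k = n + k + 1 by ring,
      ascPochhammer_succ_eval (n + k), ascPochhammer_succ_eval k, ascPochhammer_succ_eval n]
    have h3 := (ascPochhammer_pos (n + k) a ha).ne'
    have h4 : a + ((n + k : ℕ) : ℝ) ≠ 0 := by positivity
    field_simp
    push_cast
    ring

end Pochhammer

/-! ### Rearranging double series -/

theorem tsum_eq_tsum_sum_antidiagonal {f : ℕ × ℕ → ℝ} (hf : Summable f) :
    ∑' q, f q = ∑' n, ∑ p ∈ Finset.HasAntidiagonal.antidiagonal n, f p := by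
  rw [← Finset.HasAntidiagonal.sigmaAntidiagonalEquivProd.tsum_eq f]
  refine (Summable.tsum_sigma' (fun n => (hasSum_fintype _).summable)
    (Finset.HasAntidiagonal.sigmaAntidiagonalEquivProd.summable_iff.2 hf)).trans ?_
  refine tsum_congr fun n => ?_
  rw [tsum_fintype]
  exact Finset.sum_coe_sort (Finset.HasAntidiagonal.antidiagonal n) f

theorem tsum_prod_right {α β : Type*} {f : α × β → ℝ} (hf : Summable f) :
    ∑' q, f q = ∑' b, ∑' a, f (a, b) := by
  rw [← (Equiv.prodComm β α).tsum_eq f]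
  exact ((Equiv.prodComm β α).summable_iff.2 hf).tsum_prod

/-! ### Humbert's function: convergence, reduction to `₁F₁`, integration -/

section Humbert

/-- The general term of the series of `humbertPhi2`. -/
noncomputable def humbertTerm (b b' c x y : ℝ) (p : ℕ × ℕ) : ℝ :=
  ((ascPochhammer ℝ p.1).eval b * (ascPochhammer ℝ p.2).eval b') /
      ((ascPochhammer ℝ (p.1 + p.2)).eval c * ((p.1)! : ℝ) * ((p.2)! : ℝ)) *
      x ^ p.1 * y ^ p.2

/-- A majorant of the general term of the series of `humbertPhi2`. -/
noncomputable def humbertBound (b b' c x y : ℝ) (p : ℕ × ℕ) : ℝ :=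
  (max 1 (|b| / c) * |x|) ^ p.1 / (p.1)! * ((max 1 (|b'| / c) * |y|) ^ p.2 / (p.2)!)

theorem summable_humbertBound (b b' c x y : ℝ) : Summable (humbertBound b b' c x y) :=
  (Real.summable_pow_div_factorial _).mul_of_nonneg (Real.summable_pow_div_factorial _)
    (fun n => by positivity) (fun n => by positivity)

/-- Replacing `(c)_{j+k}` by the smaller `(c)_j (c)_k` factors the term into two ratios of rising
factorials, each of at most geometric growth. -/
theorem abs_humbertTerm_le {b b' c : ℝ} (hc : 0 < c) (x y : ℝ) (p : ℕ × ℕ) :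
    |humbertTerm b b' c x y p| ≤ humbertBound b b' c x y p := by
  obtain ⟨j, k⟩ := p
  have h1 := ascPochhammer_pos j c hc
  have h2 := ascPochhammer_pos k c hc
  have h3 := ascPochhammer_pos (j + k) c hc
  have h4 := ascPochhammer_eval_nonneg (abs_nonneg b) j
  have h5 := ascPochhammer_eval_nonneg (abs_nonneg b') k
  have e1 : |humbertTerm b b' c x y (j, k)| =
      |(ascPochhammer ℝ j).eval b| * |(ascPochhammer ℝ k).eval b'| /
        (ascPochhammer ℝ (j + k)).eval c * (|x| ^ j / j ! * (|y| ^ k / k !)) := by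
    simp only [humbertTerm, abs_mul, abs_div, abs_pow, abs_of_pos h3, Nat.abs_cast]
    ring
  have e2 : humbertBound b b' c x y (j, k) =
      (max 1 (|b| / c)) ^ j * (max 1 (|b'| / c)) ^ k * (|x| ^ j / j ! * (|y| ^ k / k !)) := by
    simp only [humbertBound, mul_pow]
    ring
  rw [e1, e2]
  refine mul_le_mul_of_nonneg_right ?_ (by positivity)
  calc _ ≤ (ascPochhammer ℝ j).eval |b| * (ascPochhammer ℝ k).eval |b'| /
        ((ascPochhammer ℝ j).eval c * (ascPochhammer ℝ k).eval c) := by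
        gcongr
        · exact abs_ascPochhammer_eval_le b j
        · exact abs_ascPochhammer_eval_le b' k
        · exact ascPochhammer_eval_mul_le hc j k
    _ = ((ascPochhammer ℝ j).eval |b| / (ascPochhammer ℝ j).eval c) *
        ((ascPochhammer ℝ k).eval |b'| / (ascPochhammer ℝ k).eval c) := by
        rw [mul_div_mul_comm]
    _ ≤ _ := by
        refine mul_le_mul (ascPochhammer_eval_div_le_pow hc (abs_nonneg b) j)
          (ascPochhammer_eval_div_le_pow hc (abs_nonneg b') k) (by positivity) (by positivity)

theorem summable_humbertTerm {b b' c : ℝ} (hc : 0 < c) (x y : ℝ) :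
    Summable (humbertTerm b b' c x y) :=
  Summable.of_norm_bounded (summable_humbertBound b b' c x y) (abs_humbertTerm_le hc x y)

/-- The general term of the series of Kummer's function `₁F₁(b; a; z)`. -/
noncomputable def kummerTerm (b a z : ℝ) (n : ℕ) : ℝ :=
  (ascPochhammer ℝ n).eval b / (ascPochhammer ℝ n).eval a * z ^ n / n !

theorem summable_kummerTerm {a b : ℝ} (ha : 0 < a) (hb : 0 ≤ b) (z : ℝ) :
    Summable (kummerTerm b a z) := by
  refine Summable.of_norm_bounded (Real.summable_pow_div_factorial (max 1 (b / a) * |z|))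
    fun n => ?_
  have h1 := ascPochhammer_pos n a ha
  have h2 := ascPochhammer_eval_nonneg hb n
  rw [kummerTerm, Real.norm_eq_abs, abs_div, abs_mul, abs_div, abs_of_pos h1, abs_of_nonneg h2,
    abs_pow, Nat.abs_cast, mul_pow]
  gcongr
  exact ascPochhammer_eval_div_le_pow ha hb n

/-- Kummer's transformation for Humbert's function: `Φ₂(a - b, b; a; x, y) = eˣ ₁F₁(b; a; y - x)`. -/
theorem humbertPhi2_sub_eq {a b : ℝ} (ha : 0 < a) (hb : 0 ≤ b) (x y : ℝ) :
    humbertPhi2 (a - b) b a x y = Real.exp x * ∑' n, kummerTerm b a (y - x) n := by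
  set c : ℕ → ℝ := fun n => (ascPochhammer ℝ n).eval b / (ascPochhammer ℝ n).eval a with hc
  set K := max 1 (b / a)
  have hc0 : ∀ n, 0 ≤ c n := fun n =>
    div_nonneg (ascPochhammer_eval_nonneg hb n) (ascPochhammer_eval_nonneg ha.le n)
  have hcK : ∀ n, c n ≤ K ^ n := ascPochhammer_eval_div_le_pow ha hb
  -- An absolutely summable triple series, indexed by `((i, l), k)`, to be summed in two ways.
  -- Summing over `i` apart gives `eˣ ∑ U`, and `U` grouped by `l + k` gives `₁F₁` at `y - x` by the
  -- binomial theorem. Grouping by `i + l` with `k` fixed gives `Φ₂`.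
  set T : (ℕ × ℕ) × ℕ → ℝ := fun q =>
    x ^ q.1.1 / (q.1.1)! * ((-x) ^ q.1.2 / (q.1.2)! * (y ^ q.2 / (q.2)!) * c (q.2 + q.1.2)) with hT
  set U : ℕ × ℕ → ℝ := fun q => (-x) ^ q.1 / (q.1)! * (y ^ q.2 / (q.2)!) * c (q.2 + q.1) with hU
  have hUs : Summable fun q => ‖U q‖ := by
    refine Summable.of_nonneg_of_le (fun _ => norm_nonneg _) (fun q => ?_)
      ((Real.summable_pow_div_factorial (K * |x|)).mul_of_nonneg
        (Real.summable_pow_div_factorial (K * |y|)) (fun n => by positivity)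
        (fun n => by positivity))
    simp only [hU, norm_mul, Real.norm_eq_abs, abs_div, abs_pow, abs_neg, Nat.abs_cast,
      abs_of_nonneg (hc0 _), mul_pow]
    calc _ ≤ |x| ^ q.1 / (q.1)! * (|y| ^ q.2 / (q.2)!) * K ^ (q.2 + q.1) := by
          gcongr
          exact hcK _
      _ = _ := by rw [pow_add]; ring
  have hE : Summable fun n : ℕ => ‖x ^ n / (n ! : ℝ)‖ := (Real.summable_pow_div_factorial x).norm
  have hprod : Summable fun q : ℕ × (ℕ × ℕ) => x ^ q.1 / (q.1)! * U q.2 :=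
    summable_mul_of_summable_norm hE hUs
  have hTs : Summable T := by
    rw [← (Equiv.prodAssoc ℕ ℕ ℕ).summable_iff] at hprod
    exact hprod
  have hTsum : ∑' q, T q = Real.exp x * ∑' q, U q := by
    rw [Real.exp_eq_exp_ℝ, NormedSpace.exp_eq_tsum_div, tsum_mul_tsum_of_summable_norm hE hUs]
    exact (Equiv.prodAssoc ℕ ℕ ℕ).tsum_eq fun q : ℕ × (ℕ × ℕ) => x ^ q.1 / (q.1)! * U q.2
  have hUsum : ∑' q, U q = ∑' n, kummerTerm b a (y - x) n := by
    rw [tsum_eq_tsum_sum_antidiagonal hUs.of_norm]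
    refine tsum_congr fun n => ?_
    rw [kummerTerm,
      sub_eq_neg_add, add_pow, Finset.mul_sum, Finset.sum_div,
      ← Finset.Nat.sum_antidiagonal_eq_sum_range_succ
        (fun i j => (ascPochhammer ℝ n).eval b / (ascPochhammer ℝ n).eval a *
          ((-x) ^ i * y ^ j * (n.choose i : ℝ)) / n !)]
    refine Finset.sum_congr rfl fun p hp => ?_
    rw [Finset.HasAntidiagonal.mem_antidiagonal] at hp
    subst hp
    rw [Nat.cast_choose ℝ (Nat.le_add_right _ _), Nat.add_sub_cancel_left]
    simp only [hU, hc]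
    rw [add_comm p.2 p.1]
    have := Nat.factorial_ne_zero (p.1 + p.2)
    field_simp
  -- The signs of `(-x)^l` make each antidiagonal sum an alternating difference of `c`, evaluated by
  -- Chu-Vandermonde.
  have hfib : ∀ q : ℕ × ℕ, humbertTerm (a - b) b a x y q =
      ∑ p ∈ Finset.HasAntidiagonal.antidiagonal q.1, T (p, q.2) := by
    rintro ⟨n, k⟩
    have h := sum_choose_neg_one_pow_mul_ascPochhammer_div (b := b) ha n k
    rw [humbertTerm]
    calc _ = (ascPochhammer ℝ n).eval (a - b) * (ascPochhammer ℝ k).eval b /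
          (ascPochhammer ℝ (n + k)).eval a * (x ^ n / n ! * (y ^ k / k !)) := by
          ring
      _ = _ := by
        rw [← h, Finset.sum_mul, ← Finset.Nat.sum_antidiagonal_eq_sum_range_succ
          (fun l i => (n.choose l : ℝ) * ((-1) ^ l * ((ascPochhammer ℝ (k + l)).eval b /
            (ascPochhammer ℝ (k + l)).eval a)) * (x ^ n / n ! * (y ^ k / k !))),
          ← Finset.Nat.sum_antidiagonal_swap]
        refine Finset.sum_congr rfl fun p hp => ?_
        rw [Finset.HasAntidiagonal.mem_antidiagonal] at hp
        subst hp
        simp only [Prod.fst_swap, hT, hc]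
        rw [Nat.cast_choose ℝ (Nat.le_add_left _ _), Nat.add_sub_cancel, neg_pow x, pow_add]
        have := Nat.factorial_ne_zero (p.1 + p.2)
        field_simp
  change ∑' q, humbertTerm (a - b) b a x y q = _
  rw [← hUsum, ← hTsum]
  have hHs := summable_humbertTerm (b := a - b) (b' := b) ha x y
  have hTk : ∀ k, Summable fun p => T (p, k) := fun k =>
    ((Equiv.prodComm ℕ (ℕ × ℕ)).summable_iff.2 hTs).prod_factor k
  rw [tsum_prod_right hHs, tsum_prod_right hTs]
  refine tsum_congr fun k => ?_
  rw [tsum_eq_tsum_sum_antidiagonal (hTk k)]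
  exact tsum_congr fun n => hfib (n, k)

/-- Termwise integration of `t ^ (c - 1) Φ₂(b, b'; c; u t, v t)`. -/
theorem integral_rpow_mul_humbertPhi2 {b b' c : ℝ} (hc : 0 < c) (u v : ℝ) {x : ℝ} (hx : 0 ≤ x) :
    ∫ t in Set.Ioc 0 x, t ^ (c - 1) * humbertPhi2 b b' c (u * t) (v * t) =
      x ^ c / c * humbertPhi2 b b' (c + 1) (u * x) (v * x) := by
  have hint : ∀ s : ℝ, 0 < s → IntegrableOn (fun t : ℝ => t ^ (s - 1)) (Set.Ioc 0 x) := by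
    intro s hs
    rw [← intervalIntegrable_iff_integrableOn_Ioc_of_le hx]
    exact intervalIntegral.intervalIntegrable_rpow' (by linarith)
  have hval : ∀ s : ℝ, 0 < s → ∫ t in Set.Ioc 0 x, t ^ (s - 1) = x ^ s / s := by
    intro s hs
    rw [← intervalIntegral.integral_of_le hx, integral_rpow (Or.inl (by linarith)),
      sub_add_cancel, Real.zero_rpow hs.ne', sub_zero]
  set F : ℕ × ℕ → ℝ → ℝ := fun p t => humbertTerm b b' c u v p * t ^ (c + ((p.1 + p.2 : ℕ) : ℝ) - 1)
    with hF
  have hFeq : ∀ t ∈ Set.Ioc 0 x, ∀ p, t ^ (c - 1) * humbertTerm b b' c (u * t) (v * t) p =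
      F p t := by
    intro t ht p
    simp only [hF, humbertTerm]
    rw [show c + ((p.1 + p.2 : ℕ) : ℝ) - 1 = (c - 1) + ((p.1 + p.2 : ℕ) : ℝ) by ring,
      Real.rpow_add_natCast ht.1.ne', pow_add]
    ring
  have hFint : ∀ p, IntegrableOn (F p) (Set.Ioc 0 x) := fun p =>
    (hint _ (by positivity)).const_mul _
  have hFval : ∀ p, ∫ t in Set.Ioc 0 x, F p t =
      x ^ c / c * humbertTerm b b' (c + 1) (u * x) (v * x) p := by
    intro p
    simp only [hF]
    rw [integral_const_mul, hval _ (by positivity)]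
    have h1 := (ascPochhammer_pos (p.1 + p.2) c hc).ne'
    have h2 := (ascPochhammer_pos (p.1 + p.2) (c + 1) (by positivity)).ne'
    have h3 := ascPochhammer_eval_mul_add (a := c) (p.1 + p.2)
    -- Since `x = 0` is allowed, splitting the power requires a nonzero total exponent.
    have h4 : c + ((p.1 + p.2 : ℕ) : ℝ) ≠ 0 := by positivity
    have h5 : x ^ (c + ((p.1 + p.2 : ℕ) : ℝ)) = x ^ c * x ^ p.1 * x ^ p.2 := by
      rw [mul_assoc, ← pow_add]
      exact Real.rpow_add_natCast' hx h4
    rw [h5]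
    simp only [humbertTerm, mul_pow]
    -- Moves the denominator `c + j + k` produced by integration next to `(c)_{j+k}`, where `h3`
    -- applies.
    rw [show ∀ A B C D E G H I : ℝ, A / (B * C * D) * E * G * (H / I) =
      A / (B * I * (C * D)) * E * G * H by intros; field_simp, h3]
    field_simp
  -- Bounding `1/(c+j+k)` by `1/c` leaves the majorant of the `Φ₂` series at `(ux, vx)`.
  have hFnorm : Summable fun p => ∫ t in Set.Ioc 0 x, ‖F p t‖ := by
    refine Summable.of_nonneg_of_le (fun p => integral_nonneg fun _ => norm_nonneg _) (fun p => ?_)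
      ((summable_humbertBound b b' c (u * x) (v * x)).mul_left (x ^ c / c))
    have e1 : ∫ t in Set.Ioc 0 x, ‖F p t‖ =
        |humbertTerm b b' c u v p| * (x ^ (c + ((p.1 + p.2 : ℕ) : ℝ)) /
          (c + ((p.1 + p.2 : ℕ) : ℝ))) := by
      rw [← hval _ (by positivity), ← integral_const_mul]
      refine setIntegral_congr_fun measurableSet_Ioc fun t ht => ?_
      simp only [hF, norm_mul, Real.norm_eq_abs]
      rw [abs_of_nonneg (Real.rpow_nonneg ht.1.le _)]
    have h4 : c + ((p.1 + p.2 : ℕ) : ℝ) ≠ 0 := by positivity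
    have h5 : x ^ (c + ((p.1 + p.2 : ℕ) : ℝ)) = x ^ c * (x ^ p.1 * x ^ p.2) := by
      rw [← pow_add]
      exact Real.rpow_add_natCast' hx h4
    rw [e1, h5]
    have h6 : |humbertTerm b b' c (u * x) (v * x) p| =
        |humbertTerm b b' c u v p| * (x ^ p.1 * x ^ p.2) := by
      rw [← abs_of_nonneg (show 0 ≤ x ^ p.1 * x ^ p.2 by positivity), ← abs_mul]
      congr 1
      simp only [humbertTerm, mul_pow]
      ring
    calc _ = x ^ c / (c + ((p.1 + p.2 : ℕ) : ℝ)) * |humbertTerm b b' c (u * x) (v * x) p| := by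
          rw [h6]; ring
      _ ≤ x ^ c / c * humbertBound b b' c (u * x) (v * x) p := by
          gcongr
          · simp only [Nat.cast_add, le_add_iff_nonneg_right]
            positivity
          · exact abs_humbertTerm_le hc _ _ _
  calc _ = ∫ t in Set.Ioc 0 x, ∑' p, F p t := by
        refine setIntegral_congr_fun measurableSet_Ioc fun t ht => ?_
        change t ^ (c - 1) * ∑' p, humbertTerm b b' c (u * t) (v * t) p = _
        rw [← tsum_mul_left]
        exact tsum_congr (hFeq t ht)
    _ = ∑' p, ∫ t in Set.Ioc 0 x, F p t := (integral_tsum_of_summable_integral_norm hFint hFnorm).symm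
    _ = _ := by
        rw [tsum_congr hFval, tsum_mul_left]
        rfl

end Humbert

/-! ### The binomial series and negative binomial weights -/

theorem Complex.ofReal_ascPochhammer_eval (b : ℝ) (n : ℕ) :
    (((ascPochhammer ℝ n).eval b : ℝ) : ℂ) = (ascPochhammer ℂ n).eval (b : ℂ) := by
  induction n with
  | zero => simp
  | succ n ih => simp [ascPochhammer_succ_eval, ih]

/-- The binomial series `∑ (b)_k / k! z ^ k = (1 - z) ^ (-b)`. -/
theorem hasSum_ascPochhammer_div_factorial_mul_pow (b : ℝ) {z : ℂ} (hz : ‖z‖ < 1) :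
    HasSum (fun k : ℕ => (((ascPochhammer ℝ k).eval b / k ! : ℝ) : ℂ) * z ^ k)
      (1 / (1 - z) ^ (b : ℂ)) := by
  have h := (Complex.one_div_one_sub_cpow_hasFPowerSeriesOnBall_zero (b : ℂ)).hasSum
    (y := z) (by simpa [enorm_eq_nnnorm, ← NNReal.coe_lt_coe] using hz)
  rw [zero_add] at h
  convert! h using 2 with k
  rw [FormalMultilinearSeries.ofScalars_apply_eq, smul_eq_mul]
  congr 1
  -- The power series coefficient is `Ring.choose (b + k - 1) k`, which unfolds to `multichoose b k
  -- = (b)_k / k!`.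
  have h1 := Ring.factorial_nsmul_multichoose_eq_ascPochhammer (b : ℂ) k
  rw [Polynomial.ascPochhammer_smeval_eq_eval] at h1
  rw [Ring.choose, show (b : ℂ) + k - 1 - k + 1 = b by ring, Complex.ofReal_div,
    Complex.ofReal_ascPochhammer_eval, ← h1, nsmul_eq_mul]
  have := Nat.factorial_ne_zero k
  push_cast
  field_simp

/-- The weights of the negative binomial law with (real) shape `b` and success probability `p`. -/
noncomputable def negBinomialWeight (b p : ℝ) (k : ℕ) : ℝ :=
  p ^ b * (1 - p) ^ k * ((ascPochhammer ℝ k).eval b / k !)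

theorem negBinomialWeight_nonneg {b p : ℝ} (hb : 0 < b) (hp0 : 0 < p) (hp1 : p ≤ 1) (k : ℕ) :
    0 ≤ negBinomialWeight b p k := by
  have h1 := ascPochhammer_pos k b hb
  have h2 : 0 ≤ 1 - p := by linarith
  unfold negBinomialWeight
  positivity

/-- The closed unit disc is allowed because `p > 0` makes `|(1-p)z| < 1`; it contains the values
`r/(r-it)` needed later. -/
theorem hasSum_negBinomialWeight_mul_pow {b p : ℝ} (hp0 : 0 < p) (hp1 : p ≤ 1) {z : ℂ}
    (hz : ‖z‖ ≤ 1) :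
    HasSum (fun k : ℕ => (negBinomialWeight b p k : ℂ) * z ^ k)
      ((p : ℂ) ^ (b : ℂ) * (1 / (1 - (1 - p) * z) ^ (b : ℂ))) := by
  have hz' : ‖(1 - (p : ℂ)) * z‖ < 1 := by
    have e : ‖(1 - (p : ℂ))‖ = 1 - p := by
      rw [← Complex.ofReal_one, ← Complex.ofReal_sub, Complex.norm_real, Real.norm_eq_abs,
        abs_of_nonneg (by linarith)]
    rw [norm_mul, e]
    nlinarith [norm_nonneg z]
  refine ((hasSum_ascPochhammer_div_factorial_mul_pow b hz').mul_left _).congr_fun fun k => ?_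
  rw [negBinomialWeight]
  push_cast [Complex.ofReal_cpow hp0.le]
  rw [mul_pow]
  ring

theorem hasSum_negBinomialWeight {b p : ℝ} (hp0 : 0 < p) (hp1 : p ≤ 1) :
    HasSum (negBinomialWeight b p) 1 := by
  have h := hasSum_negBinomialWeight_mul_pow (b := b) hp0 hp1 (z := 1) (by simp)
  rw [mul_one, sub_sub_cancel, mul_one_div_cancel] at h
  · rw [← Complex.hasSum_ofReal]
    simpa using h
  · rw [Complex.cpow_ne_zero_iff]
    left
    exact_mod_cast hp0.ne'

/-! ### Mixtures of Gamma laws and their characteristic functions -/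

/-- The mixture of the Gamma laws with shapes `a + k` and rate `r`, over a negative binomial `k`. -/
noncomputable def gammaMixture (a b p r : ℝ) : Measure ℝ :=
  Measure.sum fun k : ℕ => ENNReal.ofReal (negBinomialWeight b p k) • gammaMeasure (a + k) r

theorem isProbabilityMeasure_gammaMixture {a b p r : ℝ} (ha : 0 < a) (hb : 0 < b) (hp0 : 0 < p)
    (hp1 : p ≤ 1) (hr : 0 < r) : IsProbabilityMeasure (gammaMixture a b p r) := by
  constructor
  have h : ∀ k : ℕ, gammaMeasure (a + k) r Set.univ = 1 := fun k =>
    (isProbabilityMeasure_gammaMeasure (by positivity) hr).measure_univ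
  simp only [gammaMixture, Measure.sum_apply _ MeasurableSet.univ, Measure.smul_apply, h,
    smul_eq_mul, mul_one]
  have hs := hasSum_negBinomialWeight (b := b) hp0 hp1
  rw [← ENNReal.ofReal_tsum_of_nonneg (negBinomialWeight_nonneg hb hp0 hp1) hs.summable,
    hs.tsum_eq, ENNReal.ofReal_one]

theorem measurable_gammaPDF (a r : ℝ) : Measurable (gammaPDF a r) :=
  (measurable_gammaPDFReal a r).ennreal_ofReal

theorem gammaMixture_eq_withDensity (a b p r : ℝ) :
    gammaMixture a b p r = volume.withDensity fun x => ∑' k : ℕ,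
      ENNReal.ofReal (negBinomialWeight b p k) * gammaPDF (a + k) r x := by
  have h := withDensity_tsum (μ := volume) (f := fun (k : ℕ) (x : ℝ) =>
    ENNReal.ofReal (negBinomialWeight b p k) * gammaPDF (a + k) r x)
    fun k => (measurable_gammaPDF _ _).const_mul _
  have e : (fun x => ∑' k : ℕ, ENNReal.ofReal (negBinomialWeight b p k) * gammaPDF (a + k) r x) =
      ∑' k : ℕ, fun x => ENNReal.ofReal (negBinomialWeight b p k) * gammaPDF (a + k) r x := by
    ext x
    exact (tsum_apply (f := fun (k : ℕ) (x : ℝ) => ENNReal.ofReal (negBinomialWeight b p k) *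
      gammaPDF (a + k) r x) (Pi.summable.2 fun _ => ENNReal.summable)).symm
  rw [e, h, gammaMixture]
  congr 1
  ext1 k
  rw [gammaMeasure, ← withDensity_smul _ (measurable_gammaPDF _ _)]
  rfl

theorem integrable_gammaPDFReal {a r : ℝ} (ha : 0 < a) (hr : 0 < r) :
    Integrable (gammaPDFReal a r) := by
  refine ⟨(measurable_gammaPDFReal a r).aestronglyMeasurable, ?_⟩
  rw [hasFiniteIntegral_iff_ofReal (Filter.Eventually.of_forall (gammaPDFReal_nonneg ha hr))]
  exact (lintegral_gammaPDF_eq_one ha hr).trans_lt ENNReal.one_lt_top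

theorem integral_gammaPDFReal {a r : ℝ} (ha : 0 < a) (hr : 0 < r) :
    ∫ x, gammaPDFReal a r x = 1 := by
  rw [integral_eq_lintegral_of_nonneg_ae (Filter.Eventually.of_forall (gammaPDFReal_nonneg ha hr))
    (measurable_gammaPDFReal a r).aestronglyMeasurable]
  exact (congrArg ENNReal.toReal (lintegral_gammaPDF_eq_one ha hr)).trans ENNReal.toReal_one

/-- Exponential tilting of a Gamma density. -/
theorem gammaPDFReal_mul_exp {a r t : ℝ} (hr : 0 < r) (ht : t < r) (x : ℝ) :
    gammaPDFReal a r x * Real.exp (t * x) =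
      r ^ a * (1 / (r - t)) ^ a * gammaPDFReal a (r - t) x := by
  have h : 0 < r - t := by linarith
  have h' : (r - t) ^ a ≠ 0 := (Real.rpow_pos_of_pos h a).ne'
  unfold gammaPDFReal
  split_ifs
  · rw [one_div, Real.inv_rpow h.le, show -((r - t) * x) = -(r * x) + t * x by ring, Real.exp_add]
    field_simp
  · simp

theorem integrable_exp_mul_gammaMeasure {a r t : ℝ} (ha : 0 < a) (hr : 0 < r) (ht : t < r) :
    Integrable (fun x => Real.exp (t * x)) (gammaMeasure a r) := by
  rw [gammaMeasure, integrable_withDensity_iff (measurable_gammaPDF a r)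
    (Filter.Eventually.of_forall fun x => ENNReal.ofReal_lt_top)]
  refine ((integrable_gammaPDFReal ha (sub_pos.2 ht)).const_mul
    (r ^ a * (1 / (r - t)) ^ a)).congr (Filter.Eventually.of_forall fun x => ?_)
  have e : (gammaPDF a r x).toReal = gammaPDFReal a r x :=
    ENNReal.toReal_ofReal (gammaPDFReal_nonneg ha hr x)
  change _ = Real.exp (t * x) * (gammaPDF a r x).toReal
  rw [e, mul_comm (Real.exp _), gammaPDFReal_mul_exp hr ht x]

theorem mgf_gammaMeasure {a r t : ℝ} (ha : 0 < a) (hr : 0 < r) (ht : t < r) :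
    mgf id (gammaMeasure a r) t = r ^ a * (1 / (r - t)) ^ a := by
  rw [mgf, gammaMeasure, integral_withDensity_eq_integral_toReal_smul
    (measurable_gammaPDF a r) (Filter.Eventually.of_forall fun x => ENNReal.ofReal_lt_top)]
  simp_rw [gammaPDF, ENNReal.toReal_ofReal (gammaPDFReal_nonneg ha hr _), smul_eq_mul, id,
    gammaPDFReal_mul_exp hr ht]
  rw [integral_const_mul, integral_gammaPDFReal ha (sub_pos.2 ht), mul_one]

/-- Both sides are analytic on the half-plane `re z < r`, where `1/(r-z)` has positive real part and
so avoids the branch cut. They agree at real points near `0`, so the identity theorem applies. -/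
theorem complexMGF_gammaMeasure {a r : ℝ} (ha : 0 < a) (hr : 0 < r) {z : ℂ} (hz : z.re < r) :
    complexMGF id (gammaMeasure a r) z = (r : ℂ) ^ (a : ℂ) * (1 / ((r : ℂ) - z)) ^ (a : ℂ) := by
  have hopen : IsOpen {z : ℂ | z.re < r} := isOpen_lt Complex.continuous_re continuous_const
  have hsub : Set.Iio r ⊆ interior (integrableExpSet id (gammaMeasure a r)) :=
    interior_maximal (fun t ht => integrable_exp_mul_gammaMeasure ha hr ht) isOpen_Iio
  have h1 : AnalyticOnNhd ℂ (complexMGF id (gammaMeasure a r)) {z : ℂ | z.re < r} :=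
    analyticOnNhd_complexMGF.mono fun z hz => hsub hz
  have h2 : AnalyticOnNhd ℂ (fun z : ℂ => (r : ℂ) ^ (a : ℂ) * (1 / ((r : ℂ) - z)) ^ (a : ℂ))
      {z : ℂ | z.re < r} := by
    refine DifferentiableOn.analyticOnNhd (fun z hz => ?_) hopen
    have hre : 0 < ((r : ℂ) - z).re := by simpa using hz
    have hne : (r : ℂ) - z ≠ 0 := fun h => by simp [h] at hre
    have hslit : 1 / ((r : ℂ) - z) ∈ Complex.slitPlane := by
      left
      rw [one_div, Complex.inv_re]
      exact div_pos hre (Complex.normSq_pos.2 hne)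
    have hd : DifferentiableAt ℂ (fun z : ℂ => 1 / ((r : ℂ) - z)) z :=
      (differentiableAt_const _).div (by fun_prop) hne
    exact ((hd.cpow_const hslit).const_mul _).differentiableWithinAt
  refine AnalyticOnNhd.eqOn_of_preconnected_of_frequently_eq h1 h2
    (convex_halfSpace_re_lt r).isPreconnected (z₀ := ((0 : ℝ) : ℂ)) (by simpa using hr) ?_ hz
  have htend : Filter.Tendsto (fun x : ℝ => (x : ℂ)) (nhdsWithin 0 {0}ᶜ)
      (nhdsWithin ((0 : ℝ) : ℂ) {((0 : ℝ) : ℂ)}ᶜ) :=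
    Complex.continuous_ofReal.continuousWithinAt.tendsto_nhdsWithin
      fun x hx => by simpa using hx
  refine htend.frequently (Filter.Eventually.frequently ?_)
  filter_upwards [mem_nhdsWithin_of_mem_nhds (Iio_mem_nhds hr)] with x hx
  have hx' : 0 < r - x := sub_pos.2 hx
  rw [complexMGF_ofReal, mgf_gammaMeasure ha hr hx]
  push_cast [Complex.ofReal_cpow hr.le, Complex.ofReal_cpow (one_div_pos.2 hx').le]
  rfl

theorem charFun_gammaMeasure {a r : ℝ} (ha : 0 < a) (hr : 0 < r) (t : ℝ) :
    charFun (gammaMeasure a r) t =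
      (r : ℂ) ^ (a : ℂ) * (1 / ((r : ℂ) - t * Complex.I)) ^ (a : ℂ) := by
  rw [← complexMGF_id_mul_I, complexMGF_gammaMeasure ha hr (by simpa using hr)]

/-- Raising the shape by `k` multiplies the Gamma characteristic function by `(r/(r-it))^k`. What
remains is the generating function of the weights at that point. -/
theorem charFun_gammaMixture {a b p r : ℝ} (ha : 0 < a) (hb : 0 < b) (hp0 : 0 < p)
    (hp1 : p ≤ 1) (hr : 0 < r) (t : ℝ) :
    charFun (gammaMixture a b p r) t =
      (r : ℂ) ^ (a : ℂ) * (1 / ((r : ℂ) - t * Complex.I)) ^ (a : ℂ) *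
      ((p : ℂ) ^ (b : ℂ) *
        (1 / (1 - (1 - p) * (r / ((r : ℂ) - t * Complex.I))) ^ (b : ℂ))) := by
  have := isProbabilityMeasure_gammaMixture ha hb hp0 hp1 hr
  have hint : Integrable (fun x : ℝ => Complex.exp (t * x * Complex.I)) (gammaMixture a b p r) := by
    refine Integrable.of_bound (by fun_prop) 1 (Filter.Eventually.of_forall fun x => ?_)
    rw [← Complex.ofReal_mul, Complex.norm_exp_ofReal_mul_I]
  have hr0 : (r : ℂ) ≠ 0 := by exact_mod_cast hr.ne'
  have hs0 : (r : ℂ) - t * Complex.I ≠ 0 := by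
    intro h
    have := congrArg Complex.re h
    simp at this
    exact hr.ne' this
  have hz : ‖(r : ℂ) / ((r : ℂ) - t * Complex.I)‖ ≤ 1 := by
    rw [norm_div, div_le_one (norm_pos_iff.2 hs0), Complex.norm_real, Real.norm_eq_abs]
    simpa using Complex.abs_re_le_norm ((r : ℂ) - t * Complex.I)
  have h1 := hasSum_integral_measure hint
  rw [charFun_apply_real]
  refine h1.unique (((hasSum_negBinomialWeight_mul_pow (b := b) hp0 hp1 hz).mul_left _).congr_fun
    fun k => ?_)
  rw [integral_smul_measure, ENNReal.toReal_ofReal (negBinomialWeight_nonneg hb hp0 hp1 k),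
    ← charFun_apply_real, charFun_gammaMeasure (by positivity) hr, Complex.real_smul]
  push_cast
  rw [Complex.cpow_add _ _ hr0, Complex.cpow_add _ _ (one_div_ne_zero hs0), Complex.cpow_natCast,
    Complex.cpow_natCast, div_pow, div_pow, one_pow]
  ring

/-- The sum of `M` independent variables whose law is a negative binomial mixture of Gamma laws. -/
theorem map_sum_eq_gammaMixture {Ω : Type*} [MeasurableSpace Ω] {P : Measure Ω}
    [IsProbabilityMeasure P] {M : ℕ} (hM : 0 < M) {a b p r : ℝ} (ha : 0 < a) (hb : 0 < b)
    (hp0 : 0 < p) (hp1 : p ≤ 1) (hr : 0 < r) {X : Fin M → Ω → ℝ}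
    (hlaw : ∀ k, HasLaw (X k) (gammaMixture a b p r) P) (hindep : iIndepFun X P) :
    P.map (fun ω => ∑ k, X k ω) = gammaMixture (M * a) (M * b) p r := by
  have hM' : (0 : ℝ) < M := by exact_mod_cast hM
  have := isProbabilityMeasure_gammaMixture (mul_pos hM' ha) (mul_pos hM' hb) hp0 hp1 hr
  have hmeas : ∀ k, AEMeasurable (X k) P := fun k => (hlaw k).aemeasurable
  have : IsProbabilityMeasure (P.map fun ω => ∑ k, X k ω) :=
    Measure.isProbabilityMeasure_map (Finset.aemeasurable_fun_sum _ fun k _ => hmeas k)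
  refine Measure.ext_of_charFun ?_
  rw [hindep.charFun_map_fun_sum_eq_prod hmeas]
  ext t
  simp only [Finset.prod_apply, (hlaw _).map_eq, Finset.prod_const, Finset.card_univ,
    Fintype.card_fin]
  rw [charFun_gammaMixture ha hb hp0 hp1 hr,
    charFun_gammaMixture (mul_pos hM' ha) (mul_pos hM' hb) hp0 hp1 hr]
  push_cast
  -- The exponent `M` is a natural number, so taking powers raises no branch issue.
  simp only [Complex.cpow_nat_mul, mul_pow, one_div_pow]

/-! ### The shadowed law as a mixture of Gamma laws -/

theorem gammaPDFReal_add_natCast {a r x : ℝ} (ha : 0 < a) (hr : 0 < r) (hx : 0 < x) (k : ℕ) :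
    gammaPDFReal (a + k) r x =
      gammaPDFReal a r x * ((r * x) ^ k / (ascPochhammer ℝ k).eval a) := by
  have h1 := (ascPochhammer_pos k a ha).ne'
  have h2 := (Real.Gamma_pos_of_pos ha).ne'
  rw [gammaPDFReal, gammaPDFReal, if_pos hx.le, if_pos hx.le, Real.Gamma_add_natCast ha,
    add_sub_right_comm, Real.rpow_add_natCast hr.ne', Real.rpow_add_natCast hx.ne', mul_pow]
  field_simp

/-- The mass at `k` of the Poisson law with mean `l`. -/
noncomputable def poissonWeight (l : ℝ) (k : ℕ) : ℝ := Real.exp (-l) * l ^ k / k !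

theorem poissonWeight_nonneg {l : ℝ} (hl : 0 ≤ l) (k : ℕ) : 0 ≤ poissonWeight l k := by
  unfold poissonWeight
  positivity

theorem summable_poissonWeight_mul_gammaPDFReal {a r x : ℝ} (l : ℝ) (ha : 0 < a) (hr : 0 < r)
    (hx : 0 < x) : Summable fun k : ℕ => poissonWeight l k * gammaPDFReal (a + k) r x := by
  have h : Summable fun k : ℕ => (max 1 (1 / a) * (|l| * (r * x))) ^ k / k ! :=
    Real.summable_pow_div_factorial _
  refine Summable.of_norm_bounded (h.mul_left (Real.exp (-l) * gammaPDFReal a r x)) fun k => ?_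
  have h1 := ascPochhammer_pos k a ha
  have h2 := gammaPDFReal_nonneg ha hr x
  -- Uses `1 ≤ k! = (1)_k`, so that the ratio bound applies with numerator parameter `1`.
  have h3 : 1 / (ascPochhammer ℝ k).eval a ≤ max 1 (1 / a) ^ k := by
    refine le_trans ?_ (ascPochhammer_eval_div_le_pow ha zero_le_one k)
    rw [ascPochhammer_eval_one]
    gcongr
    exact_mod_cast Nat.factorial_pos k
  rw [gammaPDFReal_add_natCast ha hr hx, poissonWeight, Real.norm_eq_abs]
  simp only [abs_mul, abs_div, abs_pow, Real.abs_exp, Nat.abs_cast, abs_of_pos h1, abs_of_nonneg h2,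
    abs_of_pos hr, abs_of_pos hx]
  calc _ = Real.exp (-l) * gammaPDFReal a r x *
        ((1 / (ascPochhammer ℝ k).eval a) * (|l| * (r * x)) ^ k / k !) := by ring
    _ ≤ Real.exp (-l) * gammaPDFReal a r x * (max 1 (1 / a) ^ k * (|l| * (r * x)) ^ k / k !) := by
        gcongr
    _ = _ := by rw [← mul_pow]

/-- The conditional `κ`-`μ` law is a Poisson mixture of Gamma laws. -/
theorem kappaMuCondPDFReal_eq_tsum {γbar κ μ ξ x : ℝ} (hγ : 0 < γbar) (hκ : 0 ≤ κ) (hμ : 0 < μ)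
    (hξ : 0 < ξ) (hx : 0 < x) :
    kappaMuCondPDFReal γbar κ μ ξ x =
      ∑' k : ℕ, poissonWeight (ξ ^ 2 * μ * κ) k *
        gammaPDFReal (μ + k) (μ * (1 + κ) / γbar) x := by
  rw [kappaMuCondPDFReal, if_pos hx]
  split_ifs with h0
  -- At `κ = 0` the Poisson mean is `0`, and only `k = 0` has mass.
  · rw [h0, tsum_eq_single 0]
    · simp [poissonWeight]
    · intro k hk
      simp [poissonWeight, hk]
  have hκ' : 0 < κ := lt_of_le_of_ne hκ (Ne.symm h0)
  have hκ1 : 0 < 1 + κ := by linarith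
  rw [besselI, ← tsum_mul_left]
  refine tsum_congr fun k => ?_
  -- All real powers are reduced to powers with exponent `h`, where `μ = 2h + 1`; keeping `h` opaque
  -- makes them atoms for the final algebra.
  obtain ⟨h, hh⟩ : ∃ h, h = (μ - 1) / 2 := ⟨_, rfl⟩
  have hs : 0 < κ * (1 + κ) * x / γbar := by positivity
  have hy : 0 < μ * ξ * Real.sqrt (κ * (1 + κ) * x / γbar) := by positivity
  have e1 : (2 * μ * ξ * Real.sqrt (κ * (1 + κ) * x / γbar) / 2) ^ (2 * (k : ℝ) + (μ - 1)) =
      (μ ^ 2 * ξ ^ 2 * (κ * (1 + κ) * x / γbar)) ^ k *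
        (μ ^ h * μ ^ h * (ξ ^ h * ξ ^ h) * (κ ^ h * (1 + κ) ^ h * x ^ h / γbar ^ h)) := by
    have e : (μ * ξ * Real.sqrt (κ * (1 + κ) * x / γbar)) ^ (2 : ℝ) =
        μ * μ * (ξ * ξ) * (κ * (1 + κ) * x / γbar) := by
      rw [Real.rpow_two, mul_pow, Real.sq_sqrt hs.le]
      ring
    rw [show 2 * μ * ξ * Real.sqrt (κ * (1 + κ) * x / γbar) / 2 =
        μ * ξ * Real.sqrt (κ * (1 + κ) * x / γbar) by ring,
      show 2 * (k : ℝ) + (μ - 1) = 2 * (h + k) by rw [hh]; ring, Real.rpow_mul hy.le, e,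
      Real.rpow_add_natCast (by positivity), Real.mul_rpow (by positivity) (by positivity),
      Real.mul_rpow (by positivity) (by positivity), Real.mul_rpow hμ.le hμ.le,
      Real.mul_rpow hξ.le hξ.le, Real.div_rpow (by positivity) hγ.le,
      Real.mul_rpow (by positivity) hx.le, Real.mul_rpow hκ hκ1.le, mul_comm]
    ring
  have e2 : (x / (ξ ^ 2 * γbar)) ^ h = x ^ h / (ξ ^ h * ξ ^ h * γbar ^ h) := by
    rw [sq, Real.div_rpow hx.le (by positivity), Real.mul_rpow (by positivity) hγ.le,
      Real.mul_rpow hξ.le hξ.le]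
  have e3 : (1 + κ) ^ ((μ + 1) / 2) = (1 + κ) ^ h * (1 + κ) := by
    rw [show (μ + 1) / 2 = h + 1 by rw [hh]; ring, Real.rpow_add_one hκ1.ne']
  have hd : ∀ y : ℝ, 0 < y → y ^ (μ + k) = y ^ h * y ^ h * y * y ^ k := fun y hy => by
    rw [Real.rpow_add_natCast hy.ne', show μ = h + h + 1 by rw [hh]; ring,
      Real.rpow_add_one hy.ne', Real.rpow_add hy]
  have e4 : x ^ (μ + k - 1) = x ^ h * x ^ h * x ^ k := by
    rw [Real.rpow_sub_one hx.ne', hd x hx]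
    field_simp
  have hr : 0 < μ * (1 + κ) / γbar := by positivity
  have e5 : (μ * (1 + κ) / γbar) ^ h = μ ^ h * (1 + κ) ^ h / γbar ^ h := by
    rw [Real.div_rpow (by positivity) hγ.le, Real.mul_rpow hμ.le hκ1.le]
  rw [gammaPDFReal, if_pos hx.le, e1, ← hh, e2, e3, e4, hd _ hr, e5, poissonWeight,
    show (k : ℝ) + (μ - 1) + 1 = μ + k by ring, Real.exp_neg (ξ ^ 2 * μ * κ),
    show μ * (1 + κ) / γbar * x = μ * (1 + κ) * x / γbar by ring]
  have p1 := (Real.rpow_pos_of_pos hμ h).ne'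
  have p2 := (Real.rpow_pos_of_pos hκ' h).ne'
  have p3 := (Real.rpow_pos_of_pos hκ1 h).ne'
  have p4 := (Real.rpow_pos_of_pos hγ h).ne'
  have p5 := (Real.rpow_pos_of_pos hξ h).ne'
  have p6 := (Real.rpow_pos_of_pos hx h).ne'
  have p7 := (Real.Gamma_pos_of_pos (show 0 < μ + k by positivity)).ne'
  simp only [mul_pow, div_pow]
  field_simp
  ring

/-- A Poisson law whose mean is Gamma distributed is negative binomial. -/
theorem lintegral_poissonWeight_mul_nakagamiPDFReal {c m : ℝ} (hc : 0 ≤ c) (hm : 0 < m) (k : ℕ) :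
    ∫⁻ ξ in Set.Ioi (0 : ℝ),
      ENNReal.ofReal (poissonWeight (ξ ^ 2 * c) k) * ENNReal.ofReal (nakagamiPDFReal m ξ) =
    ENNReal.ofReal (negBinomialWeight m (m / (c + m)) k) := by
  have hs : 0 < c + m := by positivity
  have hq : -1 < 2 * m - 1 + 2 * k := by
    have := (Nat.cast_nonneg k : (0 : ℝ) ≤ k)
    linarith
  have e1 : ∀ ξ ∈ Set.Ioi (0 : ℝ),
      ENNReal.ofReal (poissonWeight (ξ ^ 2 * c) k) * ENNReal.ofReal (nakagamiPDFReal m ξ) =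
      ENNReal.ofReal (c ^ k / k ! * (2 * m ^ m / Real.Gamma m) *
        (ξ ^ (2 * m - 1 + 2 * k) * Real.exp (-(c + m) * ξ ^ (2 : ℝ)))) := by
    intro ξ hξ
    have hξ' : 0 < ξ := hξ
    rw [← ENNReal.ofReal_mul (poissonWeight_nonneg (by positivity) k), nakagamiPDFReal, if_pos hξ',
      poissonWeight, show (2 * m - 1 + 2 * (k : ℝ)) = 2 * m - 1 + (2 * k : ℕ) by push_cast; ring,
      Real.rpow_add_natCast hξ'.ne', Real.rpow_two,
      show -(c + m) * ξ ^ 2 = -(ξ ^ 2 * c) + -(m * ξ ^ 2) by ring, Real.exp_add]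
    congr 1
    ring
  have hint := integrableOn_rpow_mul_exp_neg_mul_rpow hq (p := 2) two_pos hs
  rw [setLIntegral_congr_fun measurableSet_Ioi e1,
    ← ofReal_integral_eq_lintegral_ofReal (hint.const_mul _), integral_const_mul,
    integral_rpow_mul_exp_neg_mul_rpow two_pos hq hs]
  · congr 1
    -- The integral equals `Γ(m+k) / (2 (c+m)^(m+k))`; the `2` cancels that of the Nakagami density.
    rw [show (2 * m - 1 + 2 * (k : ℝ) + 1) / 2 = m + k by ring,
      show -(2 * m - 1 + 2 * (k : ℝ) + 1) / 2 = -(m + k) by ring, Real.Gamma_add_natCast hm,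
      Real.rpow_neg hs.le, Real.rpow_add_natCast hs.ne', negBinomialWeight,
      Real.div_rpow hm.le hs.le, show 1 - m / (c + m) = c / (c + m) by field_simp; ring, div_pow]
    have h1 := (Real.Gamma_pos_of_pos hm).ne'
    field_simp
  · filter_upwards [ae_restrict_mem measurableSet_Ioi] with ξ hξ
    have hξ' : 0 < ξ := hξ
    have := Real.Gamma_pos_of_pos hm
    simp only [Pi.zero_apply]
    positivity

theorem measurable_nakagamiPDFReal (m : ℝ) : Measurable (nakagamiPDFReal m) := by
  unfold nakagamiPDFReal
  exact Measurable.ite measurableSet_Ioi (by fun_prop) measurable_const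

/-- The `κ`-`μ` shadowed law is a negative binomial mixture of Gamma laws. -/
theorem kappaMuShadowedMeasure_eq_gammaMixture {γbar κ μ m : ℝ} (hγ : 0 < γbar) (hκ : 0 ≤ κ)
    (hμ : 0 < μ) (hm : 0 < m) :
    kappaMuShadowedMeasure γbar κ μ m =
      gammaMixture μ m (m / (μ * κ + m)) (μ * (1 + κ) / γbar) := by
  have hr : 0 < μ * (1 + κ) / γbar := by positivity
  rw [gammaMixture_eq_withDensity, kappaMuShadowedMeasure]
  refine withDensity_congr_ae ?_
  -- The point `0` is discarded: the conditional density vanishes there by convention, while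
  -- `gammaPDF` uses its formula from `0 ≤ x` on.
  filter_upwards [Measure.ae_ne volume (0 : ℝ)] with x hx0
  rcases lt_or_gt_of_ne hx0 with hx | hx
  · simp [kappaMuCondPDFReal, hx.not_gt, gammaPDF_of_neg hx]
  have e1 : ∀ ξ ∈ Set.Ioi (0 : ℝ),
      ENNReal.ofReal (kappaMuCondPDFReal γbar κ μ ξ x) * ENNReal.ofReal (nakagamiPDFReal m ξ) =
      ∑' k : ℕ, gammaPDF (μ + k) (μ * (1 + κ) / γbar) x *
        (ENNReal.ofReal (poissonWeight (ξ ^ 2 * (μ * κ)) k) *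
          ENNReal.ofReal (nakagamiPDFReal m ξ)) := by
    intro ξ hξ
    have hp : ∀ k, 0 ≤ poissonWeight (ξ ^ 2 * μ * κ) k := poissonWeight_nonneg (by positivity)
    rw [kappaMuCondPDFReal_eq_tsum hγ hκ hμ hξ hx, ENNReal.ofReal_tsum_of_nonneg
      (fun k => mul_nonneg (hp k) (gammaPDFReal_nonneg (by positivity) hr x))
      (summable_poissonWeight_mul_gammaPDFReal _ hμ hr hx), ← ENNReal.tsum_mul_right]
    refine tsum_congr fun k => ?_
    rw [ENNReal.ofReal_mul (hp k), gammaPDF, mul_assoc (ξ ^ 2)]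
    ring
  rw [setLIntegral_congr_fun measurableSet_Ioi e1, lintegral_tsum]
  · refine tsum_congr fun k => ?_
    rw [lintegral_const_mul, lintegral_poissonWeight_mul_nakagamiPDFReal (by positivity) hm,
      mul_comm]
    have := measurable_nakagamiPDFReal m
    unfold poissonWeight
    fun_prop
  · intro k
    have := measurable_nakagamiPDFReal m
    unfold poissonWeight
    fun_prop

/-! ### Density and distribution function of a mixture -/

/-- The density on `x > 0` of `gammaMixture a b p r` in terms of Humbert's function. -/
noncomputable def gammaMixturePDFReal (a b p r x : ℝ) : ℝ :=
  p ^ b * r ^ a / Real.Gamma a * (x ^ (a - 1) * humbertPhi2 (a - b) b a (-r * x) (-(r * p) * x))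

theorem negBinomialWeight_mul_gammaPDFReal {a b p r x : ℝ} (ha : 0 < a) (hr : 0 < r) (hx : 0 < x)
    (k : ℕ) :
    negBinomialWeight b p k * gammaPDFReal (a + k) r x =
      p ^ b * gammaPDFReal a r x * kummerTerm b a ((1 - p) * (r * x)) k := by
  rw [gammaPDFReal_add_natCast ha hr hx, negBinomialWeight, kummerTerm, mul_pow (1 - p)]
  ring

/-- The arguments of `Φ₂` differ by `(1-p)rx`, the argument of `₁F₁`, and the prefactor `e^{-rx}`
completes the Gamma density. -/
theorem gammaMixturePDFReal_eq_tsum {a b p r x : ℝ} (ha : 0 < a) (hb : 0 < b) (hr : 0 < r)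
    (hx : 0 < x) :
    gammaMixturePDFReal a b p r x =
      ∑' k : ℕ, negBinomialWeight b p k * gammaPDFReal (a + k) r x := by
  simp_rw [negBinomialWeight_mul_gammaPDFReal ha hr hx]
  rw [tsum_mul_left, gammaMixturePDFReal, humbertPhi2_sub_eq ha hb.le,
    show -(r * p) * x - -r * x = (1 - p) * (r * x) by ring, gammaPDFReal, if_pos hx.le,
    neg_mul r x]
  ring

/-- The `Φ₂` series may have terms of both signs; positivity is visible only in the mixture series.
-/
theorem gammaMixturePDFReal_nonneg {a b p r x : ℝ} (ha : 0 < a) (hb : 0 < b) (hp0 : 0 < p)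
    (hp1 : p ≤ 1) (hr : 0 < r) (hx : 0 < x) : 0 ≤ gammaMixturePDFReal a b p r x := by
  rw [gammaMixturePDFReal_eq_tsum ha hb hr hx]
  exact tsum_nonneg fun k => mul_nonneg (negBinomialWeight_nonneg hb hp0 hp1 k)
    (gammaPDFReal_nonneg (by positivity) hr x)

theorem tsum_negBinomialWeight_mul_gammaPDF_ae_eq {a b p r : ℝ} (ha : 0 < a) (hb : 0 < b)
    (hp0 : 0 < p) (hp1 : p ≤ 1) (hr : 0 < r) :
    (fun x => ∑' k : ℕ, ENNReal.ofReal (negBinomialWeight b p k) * gammaPDF (a + k) r x)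
      =ᵐ[volume] fun x => ENNReal.ofReal (if 0 < x then gammaMixturePDFReal a b p r x else 0) := by
  filter_upwards [Measure.ae_ne volume (0 : ℝ)] with x hx0
  rcases lt_or_gt_of_ne hx0 with hx | hx
  · simp [hx.not_gt, gammaPDF_of_neg hx]
  have hw := negBinomialWeight_nonneg hb hp0 hp1
  rw [if_pos hx, gammaMixturePDFReal_eq_tsum ha hb hr hx, ENNReal.ofReal_tsum_of_nonneg
    (fun k => mul_nonneg (hw k) (gammaPDFReal_nonneg (by positivity) hr x))]
  · exact tsum_congr fun k => (ENNReal.ofReal_mul (hw k)).symm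
  · simp_rw [negBinomialWeight_mul_gammaPDFReal ha hr hx]
    exact (summable_kummerTerm ha hb.le _).mul_left _

theorem aemeasurable_gammaMixturePDF {a b p r : ℝ} (ha : 0 < a) (hb : 0 < b)
    (hp0 : 0 < p) (hp1 : p ≤ 1) (hr : 0 < r) :
    AEMeasurable fun x => ENNReal.ofReal (if 0 < x then gammaMixturePDFReal a b p r x else 0) :=
  AEMeasurable.congr (Measurable.tsum fun _ =>
    (measurable_gammaPDF _ _).const_mul _).aemeasurable
    (tsum_negBinomialWeight_mul_gammaPDF_ae_eq ha hb hp0 hp1 hr)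

theorem gammaMixture_eq_withDensity_gammaMixturePDFReal {a b p r : ℝ} (ha : 0 < a) (hb : 0 < b)
    (hp0 : 0 < p) (hp1 : p ≤ 1) (hr : 0 < r) :
    gammaMixture a b p r = volume.withDensity fun x =>
      ENNReal.ofReal (if 0 < x then gammaMixturePDFReal a b p r x else 0) := by
  rw [gammaMixture_eq_withDensity]
  exact withDensity_congr_ae (tsum_negBinomialWeight_mul_gammaPDF_ae_eq ha hb hp0 hp1 hr)

theorem cdf_gammaMixture {a b p r : ℝ} (ha : 0 < a) (hb : 0 < b) (hp0 : 0 < p)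
    (hp1 : p ≤ 1) (hr : 0 < r) (x : ℝ) :
    cdf (gammaMixture a b p r) x = if 0 ≤ x then
      p ^ b * r ^ a / Real.Gamma (a + 1) *
        (x ^ a * humbertPhi2 (a - b) b (a + 1) (-r * x) (-(r * p) * x)) else 0 := by
  have := isProbabilityMeasure_gammaMixture ha hb hp0 hp1 hr
  have e : ∀ t : ℝ, (ENNReal.ofReal (if 0 < t then gammaMixturePDFReal a b p r t else 0)).toReal =
      (Set.Ioi (0 : ℝ)).indicator (gammaMixturePDFReal a b p r) t := by
    intro t
    by_cases ht : 0 < t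
    · rw [if_pos ht, Set.indicator_of_mem (by exact ht),
        ENNReal.toReal_ofReal (gammaMixturePDFReal_nonneg ha hb hp0 hp1 hr ht)]
    · rw [if_neg ht, Set.indicator_of_notMem (by exact ht)]
      simp
  rw [cdf_eq_real, measureReal_def, gammaMixture_eq_withDensity_gammaMixturePDFReal ha hb hp0 hp1 hr,
    withDensity_apply _ measurableSet_Iic,
    ← integral_toReal (aemeasurable_gammaMixturePDF ha hb hp0 hp1 hr).restrict
      (Filter.Eventually.of_forall fun _ => ENNReal.ofReal_lt_top)]
  simp_rw [e]
  rw [setIntegral_indicator measurableSet_Ioi, Set.inter_comm, Set.Ioi_inter_Iic]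
  split_ifs with hx
  · unfold gammaMixturePDFReal
    rw [integral_const_mul, integral_rpow_mul_humbertPhi2 ha _ _ hx, Real.Gamma_add_one ha.ne']
    have := (Real.Gamma_pos_of_pos ha).ne'
    field_simp
  · rw [Set.Ioc_eq_empty (by linarith), setIntegral_empty]

/-! ### Matching constants and the law of the sum -/

theorem kappaMuShadowed_constant_eq {γbar κ μ m : ℝ} (hγ : 0 < γbar) (hκ : 0 ≤ κ) (hμ : 0 < μ)
    (hm : 0 < m) (a b : ℝ) :
    μ ^ a * m ^ b * (1 + κ) ^ a / (μ * κ + m) ^ b * (1 / γbar) ^ a =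
      (m / (μ * κ + m)) ^ b * (μ * (1 + κ) / γbar) ^ a := by
  rw [Real.div_rpow hm.le (by positivity), Real.div_rpow (x := μ * (1 + κ)) (by positivity) hγ.le,
    Real.mul_rpow hμ.le (by positivity), Real.div_rpow zero_le_one hγ.le, Real.one_rpow]
  ring

theorem kappaMuShadowedSumPDFReal_eq {M : ℕ} {γbar κ μ m : ℝ} (hγ : 0 < γbar)
    (hκ : 0 ≤ κ) (hμ : 0 < μ) (hm : 0 < m) (x : ℝ) :
    kappaMuShadowedSumPDFReal M γbar κ μ m x =
      gammaMixturePDFReal (M * μ) (M * m) (m / (μ * κ + m)) (μ * (1 + κ) / γbar) x := by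
  rw [kappaMuShadowedSumPDFReal, gammaMixturePDFReal, ← kappaMuShadowed_constant_eq hγ hκ hμ hm,
    mul_comm μ (M : ℝ), mul_comm m (M : ℝ),
    show -(μ * (1 + κ) * x) / γbar = -(μ * (1 + κ) / γbar) * x by ring,
    show -(μ * (1 + κ)) / γbar * (m * x / (μ * κ + m)) =
      -(μ * (1 + κ) / γbar * (m / (μ * κ + m))) * x by ring]
  ring

theorem kappaMuShadowedSumCDFReal_eq {M : ℕ} {γbar κ μ m : ℝ} (hγ : 0 < γbar)
    (hκ : 0 ≤ κ) (hμ : 0 < μ) (hm : 0 < m) (x : ℝ) :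
    kappaMuShadowedSumCDFReal M γbar κ μ m x =
      (m / (μ * κ + m)) ^ (M * m) * (μ * (1 + κ) / γbar) ^ (M * μ) / Real.Gamma (M * μ + 1) *
        (x ^ (M * μ) * humbertPhi2 (M * μ - M * m) (M * m) (M * μ + 1)
          (-(μ * (1 + κ) / γbar) * x) (-(μ * (1 + κ) / γbar * (m / (μ * κ + m))) * x)) := by
  rw [kappaMuShadowedSumCDFReal, ← kappaMuShadowed_constant_eq hγ hκ hμ hm,
    mul_comm μ (M : ℝ), mul_comm m (M : ℝ), add_comm 1 ((M : ℝ) * μ),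
    show -(μ * (1 + κ) * x) / γbar = -(μ * (1 + κ) / γbar) * x by ring,
    show -(μ * (1 + κ)) / γbar * (m * x / (μ * κ + m)) =
      -(μ * (1 + κ) / γbar * (m / (μ * κ + m))) * x by ring]
  ring

theorem corollary1 {Ω : Type*} [MeasurableSpace Ω] (P : Measure Ω) [IsProbabilityMeasure P]
    (M : ℕ) (hM : 0 < M) (γbar κ μ m : ℝ)
    (hγbar : 0 < γbar) (hκ : 0 ≤ κ) (hμ : 0 < μ) (hm : 0 < m)
    (γ : Fin M → Ω → ℝ)
    (hlaw : ∀ k, HasLaw (γ k) (kappaMuShadowedMeasure γbar κ μ m) P)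
    (hindep : iIndepFun γ P) :
    -- the density of the sum
    (HasPDF (fun ω => ∑ k, γ k ω) P volume ∧
      (∀ x : ℝ, 0 < x → 0 ≤ kappaMuShadowedSumPDFReal M γbar κ μ m x) ∧
      pdf (fun ω => ∑ k, γ k ω) P volume =ᵐ[volume] fun x =>
        ENNReal.ofReal (if 0 < x then kappaMuShadowedSumPDFReal M γbar κ μ m x else 0)) ∧
    -- the distribution function of the sum
    (∀ x : ℝ, cdf (P.map fun ω => ∑ k, γ k ω) x =
      if 0 ≤ x then kappaMuShadowedSumCDFReal M γbar κ μ m x else 0) := by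

  have hM' : (0 : ℝ) < M := by exact_mod_cast hM
  have ha : 0 < M * μ := mul_pos hM' hμ
  have hb : 0 < M * m := mul_pos hM' hm
  have hd : 0 < μ * κ + m := by positivity
  have hp0 : 0 < m / (μ * κ + m) := by positivity
  have hp1 : m / (μ * κ + m) ≤ 1 := by
    rw [div_le_one hd]
    linarith [mul_nonneg hμ.le hκ]
  have hr : 0 < μ * (1 + κ) / γbar := by positivity
  rw [kappaMuShadowedMeasure_eq_gammaMixture hγbar hκ hμ hm] at hlaw
  have hmap := map_sum_eq_gammaMixture hM hμ hm hp0 hp1 hr hlaw hindep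
  have hX : AEMeasurable (fun ω => ∑ k, γ k ω) P :=
    Finset.aemeasurable_fun_sum _ fun k _ => (hlaw k).aemeasurable
  have hf := aemeasurable_gammaMixturePDF ha hb hp0 hp1 hr
  have hdens := hmap.trans (gammaMixture_eq_withDensity_gammaMixturePDFReal ha hb hp0 hp1 hr)
  have hpdf : HasPDF (fun ω => ∑ k, γ k ω) P volume := hasPDF_of_map_eq_withDensity hX _ hf hdens
  simp_rw [kappaMuShadowedSumPDFReal_eq hγbar hκ hμ hm,
    kappaMuShadowedSumCDFReal_eq hγbar hκ hμ hm]
  refine ⟨⟨hpdf, fun x hx => gammaMixturePDFReal_nonneg ha hb hp0 hp1 hr hx,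
    (pdf.eq_of_map_eq_withDensity _ hf).1 hdens⟩, fun x => ?_⟩
  rw [hmap, cdf_gammaMixture ha hb hp0 hp1 hr]
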